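/- For integers $s_1,\dots,s_r\neq 0$ and $n\ge 0$ put $$\zeta_n(s_1,\dots,s_r):=\sum_{n\ge n_1>\cdots>n_r\ge 1}\ \prod_{j=1}^{r}\frac{\operatorname{sgn}(s_j)^{n_j}}{n_j^{|s_j|}},\qquad \zeta(s_1,\dots,s_r):=\lim_{n\to\infty}\zeta_n(s_1,\dots,s_r)$$ whenever the limit exists. Write $\bar s$ (or $\overline{s}$) for a negative argument $-s$, and $\{1\}_d$ for the sequence of $d$ ones. **Theorem 4.1.** Let $m,k,p\ge 0$ be integers. Then the limits defining $\zeta(\bar 1,\{1\}_a,p+3,\{1\}_b)$ and $\zeta(\overline{q+2},\{1\}_b)$ exist for all integers $a,b,q\ge 0$, and $$\begin{aligned} &(-1)^{m+1}\sum_{i=0}^{m}\frac{(\ln 2)^i}{i!}\,\zeta(\bar 1,\{1\}_{m-i},p+3,\{1\}_k) +(-1)^{p+k+1}\sum_{i=0}^{k}\frac{(\ln 2)^i}{i!}\,\zeta(\bar 1,\{1\}_{k-i},p+3,\{1\}_m)\\ &\quad=\frac{(-1)^m}{(m+1)!}(\ln 2)^{m+1}\,\zeta(\overline{p+3},\{1\}_k)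 +\frac{(-1)^{p+k}}{(k+1)!}(\ln 2)^{k+1}\,\zeta(\overline{p+3},\{1\}_m)\\ &\qquad+\sum_{i=0}^{p}(-1)^i\,\zeta(\overline{2+i},\{1\}_m)\,\zeta(\overline{p+2-i},\{1\}_k). \end{aligned}$$ -/

import Mathlib

open Filter Topology

/-- The multiple harmonic number
`ζ_n(s₁, …, s_k) = ∑_{n ≥ n₁ > n₂ > ⋯ > n_k ≥ 1} ∏_j sgn(s_j)^{n_j} / n_j^{|s_j|}`
of a list of nonzero integers (a barred argument is a negative entry), with `ζ_n(∅) = 1`.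
The sum is organized by its largest summation index `n₁`. -/
noncomputable def multipleHarmonicNumber : List ℤ → ℕ → ℝ
  | [], _ => 1
  | s :: t, n => ∑ j ∈ Finset.Icc 1 n,
      (s.sign : ℝ) ^ j / (j : ℝ) ^ s.natAbs * multipleHarmonicNumber t (j - 1)

/-- The (alternating) multiple zeta value
`ζ(s₁, …, s_k) = ∑_{n₁ > ⋯ > n_k > 0} ∏_j sgn(s_j)^{n_j} / n_j^{|s_j|}`,
the limit of its partial sums `ζ_n(s₁, …, s_k)` as `n → ∞`. -/
noncomputable def multipleZeta (s : List ℤ) : ℝ :=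
  limUnder atTop (multipleHarmonicNumber s)

/-- The list `{1}_d` consisting of `d` ones. -/
def ones (d : ℕ) : List ℤ := List.replicate d 1

/-! Deform the relation by a variable `t` in `[0, 1)`: replace `ln 2` by `log (1 + t)` and each
`ζ(-s, l)` by `altPolylog (s :: l) t`, the power series whose coefficients are the summands of
`ζ(-s, l)`. Differentiation strips the leading entry: an exponent `s + 1` drops to `s` with a factor
`1 / t`, and a leading `1` disappears with a factor `-1 / (1 + t)`. Under these rules the sums over
`i` telescope, and both sides of the deformed relation vanish at `0` and have equal derivatives, so
they agree (`logPolylogSum_identity`). The cancellation uses that `altPolylog (ones m)` is `(-1)^m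
log (1 + t)^m / m!` (`altPolylog_ones`).

The zeta values are recovered as `t → 1⁻` by Abel's theorem, which needs convergence of the series
at `t = 1`. That follows from a square-root growth bound on multiple harmonic numbers: absolutely
for leading exponent at least `2`, by summation by parts for leading `-1`. -/

/-- The summand with largest index `n` in the sum defining `ζ_N(l)`, for `l` with positive entries. -/
noncomputable def multipleHarmonicTerm : List ℤ → ℕ → ℝ
  | [], n => if n = 0 then 1 else 0
  | s :: t, n => multipleHarmonicNumber t (n - 1) / (n : ℝ) ^ s.natAbs

/-- The multiple polylogarithm `Li_l(-t)` in one variable. -/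
noncomputable def altPolylog (l : List ℤ) (t : ℝ) : ℝ :=
  ∑' n, ((-1) ^ n * multipleHarmonicTerm l n) * t ^ n

/-! ### Recursions and growth of multiple harmonic numbers. -/

theorem multipleHarmonicTerm_cons_zero {s : ℤ} (hs : 0 < s) (l : List ℤ) :
    multipleHarmonicTerm (s :: l) 0 = 0 := by
  have : s.natAbs ≠ 0 := by omega
  simp [multipleHarmonicTerm, this]

theorem multipleHarmonicNumber_cons_succ {s : ℤ} (hs : 0 < s) (l : List ℤ) (n : ℕ) :
    multipleHarmonicNumber (s :: l) (n + 1) =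
      multipleHarmonicNumber (s :: l) n + multipleHarmonicTerm (s :: l) (n + 1) := by
  simp only [multipleHarmonicNumber, multipleHarmonicTerm]
  rw [Finset.sum_Icc_succ_top (by omega)]
  rw [Int.sign_eq_one_of_pos hs]
  simp only [Int.cast_one, one_pow]
  ring

theorem multipleHarmonicNumber_succ {l : List ℤ} (hl : ∀ s ∈ l, 0 < s) (n : ℕ) :
    multipleHarmonicNumber l (n + 1) =
      multipleHarmonicNumber l n + multipleHarmonicTerm l (n + 1) := by
  cases l with
  | nil => simp [multipleHarmonicNumber, multipleHarmonicTerm]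
  | cons s l => exact multipleHarmonicNumber_cons_succ (hl s (by simp)) l n

theorem multipleHarmonicNumber_zero {l : List ℤ} (hl : ∀ s ∈ l, 0 < s) :
    multipleHarmonicNumber l 0 = multipleHarmonicTerm l 0 := by
  cases l with
  | nil => simp [multipleHarmonicNumber, multipleHarmonicTerm]
  | cons s l =>
    rw [multipleHarmonicTerm_cons_zero (hl s (by simp))]
    simp [multipleHarmonicNumber]

theorem multipleHarmonicNumber_neg_cons {s : ℤ} (hs : 0 < s) (l : List ℤ) (n : ℕ) :
    multipleHarmonicNumber (-s :: l) n =
      ∑ j ∈ Finset.range (n + 1), (-1) ^ j * multipleHarmonicTerm (s :: l) j := by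
  induction n with
  | zero => simp [multipleHarmonicNumber, multipleHarmonicTerm_cons_zero hs]
  | succ n ih =>
    rw [Finset.sum_range_succ, ← ih]
    simp only [multipleHarmonicNumber, multipleHarmonicTerm]
    rw [Finset.sum_Icc_succ_top (by omega)]
    rw [Int.sign_neg, Int.sign_eq_one_of_pos hs, Int.natAbs_neg]
    push_cast
    ring

/-- The true growth is at most a power of `log n`; the cruder `√n` survives induction on the list,
since an increment `C / √(n + 1)` is at most `2C (√(n + 1) - √n)`, which telescopes. -/
theorem multipleHarmonicNumber_bound {l : List ℤ} (hl : ∀ s ∈ l, 0 < s) :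
    ∃ C : ℝ, 0 ≤ C ∧ ∀ n : ℕ, 0 ≤ multipleHarmonicNumber l n ∧
      multipleHarmonicNumber l n ≤ C * √((n : ℝ) + 1) := by
  induction l with
  | nil =>
    refine ⟨1, by norm_num, fun n => ⟨by simp [multipleHarmonicNumber], ?_⟩⟩
    simp only [multipleHarmonicNumber, one_mul]
    exact Real.one_le_sqrt.2 (by linarith [Nat.cast_nonneg (α := ℝ) n])
  | cons s l ih =>
    obtain ⟨C, hC, h⟩ := ih (fun x hx => hl x (by simp [hx]))
    have hs : 0 < s := hl s (by simp)
    -- The sharper `√n`, not `√(n + 1)`, is what makes the telescoping close.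
    have key : ∀ n : ℕ, 0 ≤ multipleHarmonicNumber (s :: l) n ∧
        multipleHarmonicNumber (s :: l) n ≤ 2 * C * √(n : ℝ) := by
      intro n
      induction n with
      | zero => simp [multipleHarmonicNumber]
      | succ n ihn =>
        rw [multipleHarmonicNumber_cons_succ hs]
        have hpow : (n : ℝ) + 1 ≤ ((n : ℝ) + 1) ^ s.natAbs :=
          le_self_pow₀ (by linarith [Nat.cast_nonneg (α := ℝ) n]) (by omega)
        have hq : multipleHarmonicTerm (s :: l) (n + 1) ≤ C * √((n : ℝ) + 1) / (n + 1) := by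
          simp only [multipleHarmonicTerm, Nat.add_sub_cancel, Nat.cast_add, Nat.cast_one]
          exact div_le_div₀ (by positivity) (h n).2 (by positivity) hpow
        have hq0 : 0 ≤ multipleHarmonicTerm (s :: l) (n + 1) := by
          simp only [multipleHarmonicTerm, Nat.add_sub_cancel]
          exact div_nonneg (h n).1 (by positivity)
        refine ⟨add_nonneg ihn.1 hq0, ?_⟩
        have h1 : √((n : ℝ) + 1) / (n + 1) ≤ 2 * √((n : ℝ) + 1) - 2 * √(n : ℝ) := by
          rw [div_le_iff₀ (by positivity)]
          have a := Real.sq_sqrt (show (0:ℝ) ≤ n by positivity)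
          have b := Real.sq_sqrt (show (0:ℝ) ≤ n + 1 by positivity)
          have d := Real.sqrt_pos.2 (show (0:ℝ) < n + 1 by positivity)
          nlinarith [mul_nonneg d.le (sq_nonneg (√((n : ℝ) + 1) - √(n : ℝ)))]
        have h2 := mul_le_mul_of_nonneg_left h1 hC
        rw [mul_div_assoc] at hq
        push_cast
        linarith [ihn.2]
    refine ⟨2 * C, by positivity, fun n => ⟨(key n).1, (key n).2.trans ?_⟩⟩
    gcongr
    linarith

/-- Terms of a list with positive entries decay like `n ^ (1/2 - s)`. -/
theorem multipleHarmonicTerm_cons_bound {s : ℤ} {l : List ℤ} (hl : ∀ x ∈ l, 0 < x) :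
    ∃ C : ℝ, 0 ≤ C ∧ ∀ n : ℕ, 0 ≤ multipleHarmonicTerm (s :: l) (n + 1) ∧
      multipleHarmonicTerm (s :: l) (n + 1) ≤ C * √((n : ℝ) + 1) / ((n : ℝ) + 1) ^ s.natAbs := by
  obtain ⟨C, hC, h⟩ := multipleHarmonicNumber_bound hl
  refine ⟨C, hC, fun n => ?_⟩
  simp only [multipleHarmonicTerm, Nat.add_sub_cancel, Nat.cast_add, Nat.cast_one]
  exact ⟨div_nonneg (h n).1 (by positivity), by gcongr; exact (h n).2⟩

theorem multipleHarmonicTerm_bounded {l : List ℤ} (hl : ∀ x ∈ l, 0 < x) :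
    ∃ C : ℝ, ∀ n : ℕ, |multipleHarmonicTerm l n| ≤ C := by
  cases l with
  | nil => exact ⟨1, fun n => by simp only [multipleHarmonicTerm]; split_ifs <;> simp⟩
  | cons s l =>
    have hs : 0 < s := hl s (by simp)
    obtain ⟨C, hC, h⟩ := multipleHarmonicTerm_cons_bound (s := s) (l := l)
      (fun x hx => hl x (by simp [hx]))
    refine ⟨C, fun n => ?_⟩
    cases n with
    | zero => simpa [multipleHarmonicTerm_cons_zero hs]
    | succ n =>
      rw [abs_of_nonneg (h n).1]
      refine (h n).2.trans (div_le_of_le_mul₀ (by positivity) hC ?_)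
      have hn : (1 : ℝ) ≤ n + 1 := by linarith [Nat.cast_nonneg (α := ℝ) n]
      gcongr
      calc √((n : ℝ) + 1) ≤ n + 1 := Real.sqrt_le_iff.2 ⟨by linarith, by nlinarith⟩
        _ ≤ _ := le_self_pow₀ hn (by omega)

/-! ### Convergence of the alternating series. -/

theorem summable_sqrt_div_sq : Summable fun n : ℕ => √((n : ℝ) + 1) / ((n : ℝ) + 1) ^ 2 := by
  have h : Summable fun n : ℕ => 1 / (((n + 1 : ℕ) : ℝ) ^ (3 / 2 : ℝ)) :=
    (summable_nat_add_iff 1).2 (Real.summable_one_div_nat_rpow.2 (by norm_num))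
  refine h.congr fun n => ?_
  push_cast
  have hn : (0 : ℝ) < n + 1 := by positivity
  rw [Real.sqrt_eq_rpow, ← Real.rpow_natCast, ← Real.rpow_sub hn, one_div, ← Real.rpow_neg hn.le]
  norm_num

theorem exists_tendsto_of_summable_succ {u : ℕ → ℝ} (h : Summable fun n => u (n + 1)) :
    ∃ a, Tendsto (fun n => ∑ j ∈ Finset.range (n + 1), u j) atTop (𝓝 a) :=
  ⟨_, (((summable_nat_add_iff 1).1 h).hasSum.tendsto_sum_nat).comp (tendsto_add_atTop_nat 1)⟩

theorem exists_tendsto_multipleHarmonicNumber_neg {s : ℤ} (hs : 2 ≤ s) {l : List ℤ}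
    (hl : ∀ x ∈ l, 0 < x) :
    ∃ a, Tendsto (multipleHarmonicNumber (-s :: l)) atTop (𝓝 a) := by
  rw [funext (multipleHarmonicNumber_neg_cons (by omega) l)]
  obtain ⟨C, hC, h⟩ := multipleHarmonicTerm_cons_bound (s := s) hl
  refine exists_tendsto_of_summable_succ
    ((summable_sqrt_div_sq.mul_left C).of_norm_bounded fun n => ?_)
  rw [norm_mul, norm_pow, norm_neg, norm_one, one_pow, one_mul, Real.norm_of_nonneg (h n).1,
    ← mul_div_assoc]
  refine (h n).2.trans ?_
  gcongr
  · linarith [Nat.cast_nonneg (α := ℝ) n]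
  · omega

/-- An alternating series whose terms tend to zero with bounded variation converges. -/
theorem exists_tendsto_alternating {b : ℕ → ℝ} (hb : Tendsto b atTop (𝓝 0))
    (hd : Summable fun n => b (n + 1) - b n) :
    ∃ a, Tendsto (fun n => ∑ j ∈ Finset.range n, (-1) ^ j * b j) atTop (𝓝 a) := by
  have habs : Summable fun n => (-1) ^ n * (b (n + 1) - b n) :=
    hd.abs.of_norm_bounded fun n => by simp
  have hz : Tendsto (fun n => (-1) ^ n * b n) atTop (𝓝 0) := by
    rw [tendsto_zero_iff_abs_tendsto_zero] at hb ⊢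
    refine hb.congr fun n => by simp [abs_mul]
  -- Summation by parts: the series of differences converges absolutely.
  have heq : ∀ n, ∑ j ∈ Finset.range n, (-1) ^ j * b j =
      (b 0 - (-1) ^ n * b n - ∑ j ∈ Finset.range n, (-1) ^ j * (b (j + 1) - b j)) / 2 := by
    intro n
    induction n with
    | zero => simp
    | succ n ih => rw [Finset.sum_range_succ, Finset.sum_range_succ, ih]; ring
  simp_rw [heq]
  exact ⟨_, ((tendsto_const_nhds.sub hz).sub habs.hasSum.tendsto_sum_nat).div_const 2⟩

theorem tendsto_sqrt_div : Tendsto (fun n : ℕ => √((n : ℝ) + 1) / ((n : ℝ) + 1)) atTop (𝓝 0) := by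
  simp_rw [Real.sqrt_div_self]
  refine tendsto_inv_atTop_zero.comp (Real.tendsto_sqrt_atTop.comp ?_)
  exact tendsto_atTop_add_const_right _ _ tendsto_natCast_atTop_atTop

/-- The unsigned terms are `ζ_n(s, l) / (n + 1)`: they tend to zero and their consecutive
differences are `O(n^(-3/2))`. -/
theorem exists_tendsto_multipleHarmonicNumber_neg_one {s : ℤ} (hs : 0 < s) {l : List ℤ}
    (hl : ∀ x ∈ l, 0 < x) :
    ∃ a, Tendsto (multipleHarmonicNumber (-1 :: s :: l)) atTop (𝓝 a) := by
  rw [funext (multipleHarmonicNumber_neg_cons one_pos (s :: l))]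
  have hsl : ∀ x ∈ s :: l, 0 < x := by simpa [hs] using hl
  obtain ⟨C, hC, h⟩ := multipleHarmonicNumber_bound hsl
  obtain ⟨D, hD, h'⟩ := multipleHarmonicTerm_cons_bound (s := s) hl
  set b : ℕ → ℝ := fun n => multipleHarmonicTerm (1 :: s :: l) (n + 1) with hbdef
  have hbn : ∀ n, b n = multipleHarmonicNumber (s :: l) n / ((n : ℝ) + 1) := by
    intro n; simp [hbdef, multipleHarmonicTerm]
  have hb : Tendsto b atTop (𝓝 0) := by
    have := tendsto_sqrt_div.const_mul C
    rw [mul_zero] at this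
    refine squeeze_zero (fun n => ?_) (fun n => ?_) this
    · rw [hbn]; exact div_nonneg (h n).1 (by positivity)
    · rw [hbn, ← mul_div_assoc]; gcongr; exact (h n).2
  have hd : Summable fun n => b (n + 1) - b n := by
    refine (summable_sqrt_div_sq.mul_left (C + D)).of_norm_bounded fun n => ?_
    rw [hbn, hbn, multipleHarmonicNumber_cons_succ hs, Real.norm_eq_abs]
    have e : (multipleHarmonicNumber (s :: l) n + multipleHarmonicTerm (s :: l) (n + 1)) /
          (((n + 1 : ℕ) : ℝ) + 1) - multipleHarmonicNumber (s :: l) n / ((n : ℝ) + 1) =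
        multipleHarmonicTerm (s :: l) (n + 1) / ((n : ℝ) + 1 + 1) -
          multipleHarmonicNumber (s :: l) n / (((n : ℝ) + 1) * ((n : ℝ) + 1 + 1)) := by
      push_cast
      field_simp
      ring
    have hn : (0 : ℝ) ≤ n := by positivity
    have e1 : multipleHarmonicTerm (s :: l) (n + 1) / ((n : ℝ) + 1 + 1) ≤
        D * (√((n : ℝ) + 1) / ((n : ℝ) + 1) ^ 2) := by
      rw [pow_two, ← div_div, ← mul_div_assoc, ← mul_div_assoc]
      refine div_le_div₀ (by positivity) ((h' n).2.trans ?_) (by positivity) (by linarith)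
      gcongr
      exact le_self_pow₀ (by linarith) (by omega)
    have e2 : multipleHarmonicNumber (s :: l) n / (((n : ℝ) + 1) * ((n : ℝ) + 1 + 1)) ≤
        C * (√((n : ℝ) + 1) / ((n : ℝ) + 1) ^ 2) := by
      rw [← mul_div_assoc]
      refine div_le_div₀ (by positivity) (h n).2 (by positivity) (by nlinarith)
    have e3 : 0 ≤ multipleHarmonicTerm (s :: l) (n + 1) / ((n : ℝ) + 1 + 1) :=
      div_nonneg (h' n).1 (by positivity)
    have e4 : 0 ≤ multipleHarmonicNumber (s :: l) n / (((n : ℝ) + 1) * ((n : ℝ) + 1 + 1)) :=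
      div_nonneg (h n).1 (by positivity)
    have e5 : 0 ≤ √((n : ℝ) + 1) / ((n : ℝ) + 1) ^ 2 := by positivity
    rw [e, abs_le]
    constructor <;> nlinarith
  obtain ⟨a, ha⟩ := exists_tendsto_alternating hb hd
  -- Since `b j` is the term of index `j + 1`, its sign is off by one factor `-1`.
  refine ⟨-a, ha.neg.congr fun n => ?_⟩
  rw [Finset.sum_range_succ', multipleHarmonicTerm_cons_zero one_pos, ← Finset.sum_neg_distrib,
    mul_zero, add_zero]
  exact Finset.sum_congr rfl fun j _ => by rw [pow_succ]; ring

/-! ### Termwise differentiation and the differential equations of polylogarithms. -/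

theorem summable_succ_mul_geometric {u : ℕ → ℝ} {C : ℝ} (hu : ∀ n, |u n| ≤ C) {t : ℝ}
    (ht : |t| < 1) : Summable fun n : ℕ => ((n : ℝ) + 1) * u (n + 1) * t ^ n := by
  have h0 := summable_pow_mul_geometric_of_norm_lt_one 1 (r := |t|) (by simpa using ht)
  have h1 := summable_pow_mul_geometric_of_norm_lt_one 0 (r := |t|) (by simpa using ht)
  refine ((h0.add h1).mul_left C).of_norm_bounded fun n => ?_
  rw [norm_mul, norm_mul, norm_pow, Real.norm_eq_abs, Real.norm_eq_abs, Real.norm_eq_abs,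
    abs_of_nonneg (by positivity : (0 : ℝ) ≤ n + 1)]
  have := mul_le_mul_of_nonneg_left (hu (n + 1))
    (by positivity : 0 ≤ ((n : ℝ) + 1) * |t| ^ n)
  calc _ = ((n : ℝ) + 1) * |t| ^ n * |u (n + 1)| := by ring
    _ ≤ _ := this
    _ = _ := by ring

theorem summable_mul_geometric {u : ℕ → ℝ} {C : ℝ} (hu : ∀ n, |u n| ≤ C) {t : ℝ}
    (ht : |t| < 1) : Summable fun n : ℕ => u n * t ^ n := by
  have h1 := summable_geometric_of_lt_one (abs_nonneg t) ht
  refine (h1.mul_left C).of_norm_bounded fun n => ?_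
  rw [norm_mul, norm_pow, Real.norm_eq_abs, Real.norm_eq_abs]
  exact mul_le_mul_of_nonneg_right (hu n) (by positivity)

theorem hasDerivAt_tsum_mul_pow {u : ℕ → ℝ} {C : ℝ} (hu : ∀ n, |u n| ≤ C) {t : ℝ}
    (ht : |t| < 1) :
    HasDerivAt (fun x => ∑' n, u n * x ^ n) (∑' n : ℕ, ((n : ℝ) + 1) * u (n + 1) * t ^ n) t := by
  obtain ⟨r, hr, hr1⟩ := exists_between ht
  have hr0 : 0 ≤ r := (abs_nonneg t).trans hr.le
  have hsum : Summable fun n : ℕ => C * ((n : ℝ) * r ^ (n - 1)) := by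
    refine Summable.mul_left C ((summable_nat_add_iff 1).1 ?_)
    have := summable_succ_mul_geometric (u := fun _ => 1) (C := 1) (by simp)
      (t := r) (by rwa [abs_of_nonneg hr0])
    exact this.congr fun n => by simp
  have hs : Summable fun n : ℕ => u n * ((n : ℝ) * t ^ (n - 1)) := by
    refine (summable_nat_add_iff 1).1 ((summable_succ_mul_geometric hu ht).congr fun n => ?_)
    rw [Nat.add_sub_cancel]; push_cast; ring
  have key := hasDerivAt_tsum_of_isPreconnected (t := Set.Ioo (-r) r) (y₀ := 0) (y := t)
    (g := fun n x => u n * x ^ n) (g' := fun n x => u n * ((n : ℝ) * x ^ (n - 1)))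
    hsum isOpen_Ioo isPreconnected_Ioo
    (fun n y _ => (hasDerivAt_pow n y).const_mul (u n))
    (fun n y hy => ?_) ⟨by linarith [(abs_nonneg t).trans_lt hr], (abs_nonneg t).trans_lt hr⟩
    (summable_mul_geometric hu (by simp)) (abs_lt.1 hr)
  · rw [hs.tsum_eq_zero_add] at key
    simp only [Nat.cast_zero, zero_mul, mul_zero, zero_add, Nat.add_sub_cancel] at key
    refine key.congr_deriv (tsum_congr fun n => ?_)
    push_cast
    ring
  · rw [norm_mul, norm_mul, norm_pow, Real.norm_eq_abs, Real.norm_eq_abs, Real.norm_eq_abs,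
      abs_of_nonneg (by positivity : (0 : ℝ) ≤ n)]
    have hy' : |y| ≤ r := (abs_lt.2 hy).le
    have hC : 0 ≤ C := (abs_nonneg _).trans (hu 0)
    gcongr
    exact hu n

theorem altPolylog_coeff_bounded {l : List ℤ} (hl : ∀ x ∈ l, 0 < x) :
    ∃ C : ℝ, ∀ n : ℕ, |(-1) ^ n * multipleHarmonicTerm l n| ≤ C := by
  obtain ⟨C, hC⟩ := multipleHarmonicTerm_bounded hl
  exact ⟨C, fun n => by simpa [abs_mul] using hC n⟩

theorem hasDerivAt_altPolylog {l : List ℤ} (hl : ∀ x ∈ l, 0 < x) {t : ℝ} (ht : |t| < 1) :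
    HasDerivAt (altPolylog l) (∑' n : ℕ, ((n : ℝ) + 1) *
      ((-1) ^ (n + 1) * multipleHarmonicTerm l (n + 1)) * t ^ n) t := by
  obtain ⟨C, hC⟩ := altPolylog_coeff_bounded hl
  exact hasDerivAt_tsum_mul_pow hC ht

theorem altPolylog_cons_zero {s : ℤ} (hs : 0 < s) (l : List ℤ) : altPolylog (s :: l) 0 = 0 := by
  rw [altPolylog, tsum_eq_single 0 (fun n hn => by simp [hn])]
  simp [multipleHarmonicTerm_cons_zero hs]

theorem succ_mul_multipleHarmonicTerm {s : ℤ} (hs : 0 < s) (l : List ℤ) (n : ℕ) :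
    ((n : ℝ) + 1) * multipleHarmonicTerm ((s + 1) :: l) (n + 1) =
      multipleHarmonicTerm (s :: l) (n + 1) := by
  have h : (s + 1).natAbs = s.natAbs + 1 := by omega
  simp only [multipleHarmonicTerm, h, Nat.add_sub_cancel, Nat.cast_add, Nat.cast_one]
  field_simp
  ring

theorem hasDerivAt_altPolylog_succ {s : ℤ} (hs : 0 < s) {l : List ℤ} (hl : ∀ x ∈ l, 0 < x)
    {t : ℝ} (ht : |t| < 1) (ht0 : t ≠ 0) :
    HasDerivAt (altPolylog ((s + 1) :: l)) (altPolylog (s :: l) t / t) t := by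
  have h1 : ∀ x ∈ (s + 1) :: l, 0 < x := by
    simp only [List.mem_cons, forall_eq_or_imp]; exact ⟨by omega, hl⟩
  have h2 : ∀ x ∈ s :: l, 0 < x := by
    simp only [List.mem_cons, forall_eq_or_imp]; exact ⟨hs, hl⟩
  refine (hasDerivAt_altPolylog h1 ht).congr_deriv ?_
  obtain ⟨C, hC⟩ := altPolylog_coeff_bounded h2
  rw [eq_div_iff ht0, altPolylog, (summable_mul_geometric hC ht).tsum_eq_zero_add,
    multipleHarmonicTerm_cons_zero hs, ← tsum_mul_right]
  simp only [mul_zero, zero_mul, zero_add]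
  refine tsum_congr fun n => ?_
  rw [← succ_mul_multipleHarmonicTerm hs]
  ring

/-- The derivative has coefficients `-(-1)^n ζ_n(l)`. Multiplying by `1 + t` takes differences of
consecutive harmonic numbers, leaving the summands of `l`. -/
theorem hasDerivAt_altPolylog_one {l : List ℤ} (hl : ∀ x ∈ l, 0 < x) {t : ℝ} (ht : |t| < 1) :
    HasDerivAt (altPolylog (1 :: l)) (-(altPolylog l t) / (1 + t)) t := by
  have h1 : ∀ x ∈ 1 :: l, 0 < x := by
    simp only [List.mem_cons, forall_eq_or_imp]; exact ⟨one_pos, hl⟩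
  refine (hasDerivAt_altPolylog h1 ht).congr_deriv ?_
  have ht1 : (1 + t) ≠ 0 := by linarith [(abs_lt.1 ht).1]
  obtain ⟨C, hC⟩ := altPolylog_coeff_bounded hl
  obtain ⟨D, hD⟩ := altPolylog_coeff_bounded h1
  have hs := summable_succ_mul_geometric hD ht
  have hc : ∀ n : ℕ, ((n : ℝ) + 1) * ((-1) ^ (n + 1) * multipleHarmonicTerm (1 :: l) (n + 1)) =
      -((-1) ^ n * multipleHarmonicNumber l n) := by
    intro n
    simp only [multipleHarmonicTerm, Nat.add_sub_cancel, Nat.cast_add, Nat.cast_one,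
      Int.natAbs_one, pow_one]
    field_simp
    ring
  simp_rw [hc] at hs ⊢
  have hs' : Summable fun n : ℕ => -((-1) ^ n * multipleHarmonicNumber l n) * t ^ (n + 1) :=
    (hs.mul_right t).congr fun n => by ring
  rw [eq_div_iff ht1, mul_add, mul_one, ← tsum_mul_right, altPolylog,
    (summable_mul_geometric hC ht).tsum_eq_zero_add, hs.tsum_eq_zero_add, neg_add, ← tsum_neg,
    add_assoc, ← Summable.tsum_add ((summable_nat_add_iff 1).2 hs) (hs.mul_right t),
    multipleHarmonicNumber_zero hl]
  congr 1
  · ring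
  · refine tsum_congr fun n => ?_
    rw [multipleHarmonicNumber_succ hl]
    ring

/-- Only continuity is asked at `0`, because the derivative formulas used later contain `1 / t`. -/
theorem eq_of_hasDerivAt_eq {f g d : ℝ → ℝ} (h0 : f 0 = g 0) (hf : ContinuousAt f 0)
    (hg : ContinuousAt g 0) (hfd : ∀ x ∈ Set.Ioo (0 : ℝ) 1, HasDerivAt f (d x) x)
    (hgd : ∀ x ∈ Set.Ioo (0 : ℝ) 1, HasDerivAt g (d x) x) {t : ℝ} (ht : t ∈ Set.Ico (0 : ℝ) 1) :
    f t = g t := by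
  rcases ht.1.eq_or_lt with rfl | h
  · exact h0
  have hd : ∀ x ∈ Set.Ioo (0 : ℝ) t, HasDerivAt (fun y => f y - g y) 0 x := fun x hx =>
    ((hfd x ⟨hx.1, hx.2.trans ht.2⟩).sub (hgd x ⟨hx.1, hx.2.trans ht.2⟩)).congr_deriv (sub_self _)
  have hc : ContinuousOn (fun y => f y - g y) (Set.Icc 0 t) := by
    intro x hx
    refine ContinuousAt.continuousWithinAt ?_
    rcases hx.1.eq_or_lt with rfl | hx0
    · exact hf.sub hg
    · have hx' : x ∈ Set.Ioo (0 : ℝ) 1 := ⟨hx0, hx.2.trans_lt ht.2⟩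
      exact (hfd x hx').continuousAt.sub (hgd x hx').continuousAt
  obtain ⟨c, -, hc⟩ := exists_hasDerivAt_eq_slope _ (fun _ => 0) h hc hd
  rw [eq_comm, div_eq_zero_iff] at hc
  rcases hc with hc | hc <;> linarith

theorem ones_pos (d : ℕ) : ∀ x ∈ ones d, 0 < x := by
  intro x hx
  rw [List.eq_of_mem_replicate hx]
  exact one_pos

theorem ones_succ (d : ℕ) : ones (d + 1) = 1 :: ones d := rfl

theorem ones_append_pos {l : List ℤ} (hl : ∀ x ∈ l, 0 < x) (d : ℕ) :
    ∀ x ∈ ones d ++ l, 0 < x := by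
  intro x hx
  rcases List.mem_append.1 hx with h | h
  exacts [ones_pos d x h, hl x h]

/-! ### Divided powers of the logarithm. -/

/-- The divided power `log(1 + t)^i / i!`. -/
noncomputable def logPow (i : ℕ) (t : ℝ) : ℝ := Real.log (1 + t) ^ i / (i.factorial : ℝ)

theorem logPow_zero (t : ℝ) : logPow 0 t = 1 := by simp [logPow]

theorem logPow_succ_zero (i : ℕ) : logPow (i + 1) 0 = 0 := by simp [logPow]

theorem hasDerivAt_logPow_succ (i : ℕ) {t : ℝ} (ht : 1 + t ≠ 0) :
    HasDerivAt (logPow (i + 1)) (logPow i t / (1 + t)) t := by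
  have h := ((((hasDerivAt_id t).const_add 1).log ht).pow (i + 1)).div_const
    ((i + 1).factorial : ℝ)
  refine h.congr_deriv ?_
  rw [Nat.factorial_succ]
  simp only [logPow, id, Nat.add_sub_cancel]
  push_cast
  field_simp

theorem continuousAt_logPow (i : ℕ) {t : ℝ} (ht : 1 + t ≠ 0) : ContinuousAt (logPow i) t := by
  unfold logPow
  fun_prop (disch := assumption)

theorem altPolylog_ones (m : ℕ) {t : ℝ} (ht : t ∈ Set.Ico (0 : ℝ) 1) :
    altPolylog (ones m) t = (-1) ^ m * logPow m t := by
  induction m generalizing t with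
  | zero =>
    rw [logPow_zero, altPolylog, tsum_eq_single 0]
    · simp [ones, multipleHarmonicTerm]
    · intro n hn
      simp [ones, multipleHarmonicTerm, hn]
  | succ m ih =>
    have habs : ∀ x ∈ Set.Ioo (0 : ℝ) 1, |x| < 1 := fun x hx => by
      rw [abs_of_pos hx.1]; exact hx.2
    refine eq_of_hasDerivAt_eq (d := fun x => -(altPolylog (ones m) x) / (1 + x))
      (g := fun x => (-1) ^ (m + 1) * logPow (m + 1) x) ?_ ?_ ?_
      (fun x hx => hasDerivAt_altPolylog_one (ones_pos m) (habs x hx)) (fun x hx => ?_) ht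
    · rw [altPolylog_cons_zero one_pos, logPow_succ_zero, mul_zero]
    · exact (hasDerivAt_altPolylog_one (ones_pos m) (by simp)).continuousAt
    · exact (continuousAt_logPow _ (by norm_num)).const_mul _
    · refine ((hasDerivAt_logPow_succ m (by linarith [hx.1])).const_mul _).congr_deriv ?_
      rw [ih ⟨hx.1.le, hx.2⟩]
      ring

/-! ### The deformed identity. -/

/-- The `log(1 + t)`-weighted sum of polylogarithms with leading strings of ones. -/
noncomputable def logPolylogSum (m : ℕ) (l : List ℤ) (t : ℝ) : ℝ :=
  ∑ i ∈ Finset.range (m + 1), logPow i t * altPolylog (1 :: (ones (m - i) ++ l)) t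

theorem logPolylogSum_zero (m : ℕ) (l : List ℤ) : logPolylogSum m l 0 = 0 :=
  Finset.sum_eq_zero fun i _ => by rw [altPolylog_cons_zero one_pos, mul_zero]

theorem hasDerivAt_logPolylogSum (m : ℕ) {l : List ℤ} (hl : ∀ x ∈ l, 0 < x) {t : ℝ}
    (ht : |t| < 1) :
    HasDerivAt (logPolylogSum m l) (-(logPow m t * altPolylog l t / (1 + t))) t := by
  have ht1 : (1 + t) ≠ 0 := by linarith [(abs_lt.1 ht).1]
  set D : ℕ → ℝ := fun i => match i with
    | 0 => 0
    | i + 1 => logPow i t / (1 + t) with hD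
  have hL : ∀ i, HasDerivAt (logPow i) (D i) t := by
    intro i
    cases i with
    | zero => exact (hasDerivAt_const t (1 : ℝ)).congr_of_eventuallyEq (.of_forall logPow_zero)
    | succ i => exact hasDerivAt_logPow_succ i ht1
  have h := HasDerivAt.fun_sum (u := Finset.range (m + 1)) fun i _ => (hL i).mul
    (hasDerivAt_altPolylog_one (ones_append_pos hl (m - i)) ht)
  refine h.congr_deriv ?_
  -- The product rule splits the `i`-th term into two halves that cancel against its neighbours; `G
  -- 0` vanishes as `D 0 = 0`, so only `G (m + 1)` survives.
  set G : ℕ → ℝ := fun i => D i * altPolylog (ones (m + 1 - i) ++ l) t with hG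
  have hterm : ∀ i ∈ Finset.range (m + 1),
      D i * altPolylog (1 :: (ones (m - i) ++ l)) t +
        logPow i t * (-(altPolylog (ones (m - i) ++ l) t) / (1 + t)) = G i - G (i + 1) := by
    intro i hi
    have e1 : m + 1 - i = m - i + 1 := by have := Finset.mem_range.1 hi; omega
    have e2 : m + 1 - (i + 1) = m - i := by omega
    simp only [hG, e1, e2, ones_succ, List.cons_append, hD]
    ring
  rw [Finset.sum_congr rfl hterm, Finset.sum_range_sub']
  simp only [hG, hD, Nat.sub_self, ones, List.replicate_zero, List.nil_append]
  ring

/-- The bilinear alternating sum of products of polylogarithms of complementary leading index. -/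
noncomputable def polylogConvolution (m k p : ℕ) (t : ℝ) : ℝ :=
  ∑ i ∈ Finset.range (p + 1), (-1) ^ i * altPolylog (((i : ℤ) + 2) :: ones m) t *
    altPolylog (((p : ℤ) + 2 - (i : ℤ)) :: ones k) t

/-- Lowering the left index of one product meets lowering the right index of its predecessor, with
opposite sign. Only the two ends remain, where one index has reached `1`. -/
theorem hasDerivAt_polylogConvolution (m k p : ℕ) {t : ℝ} (ht : t ∈ Set.Ioo (0 : ℝ) 1) :
    HasDerivAt (polylogConvolution m k p)
      ((altPolylog (ones (m + 1)) t * altPolylog (((p : ℤ) + 2) :: ones k) t +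
        (-1) ^ p * altPolylog (((p : ℤ) + 2) :: ones m) t * altPolylog (ones (k + 1)) t) / t) t := by
  have ht1 : |t| < 1 := by rw [abs_of_pos ht.1]; exact ht.2
  set G : ℕ → ℝ := fun i => (-1) ^ i * altPolylog (((i : ℤ) + 1) :: ones m) t *
    altPolylog (((p : ℤ) + 2 - (i : ℤ)) :: ones k) t / t with hG
  have hterm : ∀ i ∈ Finset.range (p + 1), HasDerivAt
      (fun x => (-1) ^ i * altPolylog (((i : ℤ) + 2) :: ones m) x *
        altPolylog (((p : ℤ) + 2 - (i : ℤ)) :: ones k) x) (G i - G (i + 1)) t := by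
    intro i hi
    have hi' := Finset.mem_range.1 hi
    have h1 := hasDerivAt_altPolylog_succ (s := (i : ℤ) + 1) (by omega) (ones_pos m) ht1 ht.1.ne'
    have h2 := hasDerivAt_altPolylog_succ (s := (p : ℤ) + 1 - i) (by omega) (ones_pos k) ht1 ht.1.ne'
    rw [show (i : ℤ) + 1 + 1 = i + 2 by ring] at h1
    rw [show (p : ℤ) + 1 - i + 1 = p + 2 - i by ring] at h2
    refine ((h1.const_mul _).mul h2).congr_deriv ?_
    simp only [hG]
    push_cast
    rw [show (i : ℤ) + 1 + 1 = i + 2 by ring, show (p : ℤ) + 2 - (i + 1) = p + 1 - i by ring]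
    ring
  refine (HasDerivAt.fun_sum hterm).congr_deriv ?_
  rw [Finset.sum_range_sub']
  simp only [hG]
  push_cast
  rw [show (p : ℤ) + 1 + 1 = p + 2 by ring, show (p : ℤ) + 2 - (p + 1) = 1 by ring]
  simp only [ones_succ, sub_zero]
  ring

theorem continuousAt_altPolylog_zero {l : List ℤ} (hl : ∀ x ∈ l, 0 < x) :
    ContinuousAt (altPolylog l) 0 :=
  (hasDerivAt_altPolylog hl (by simp)).continuousAt

theorem cons_ones_pos {s : ℤ} (hs : 0 < s) (d : ℕ) : ∀ x ∈ s :: ones d, 0 < x := by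
  simp only [List.mem_cons, forall_eq_or_imp]
  exact ⟨hs, ones_pos d⟩

/-- The functional identity whose limit at `t = 1` is the relation between zeta values. -/
theorem logPolylogSum_identity (m k p : ℕ) {t : ℝ} (ht : t ∈ Set.Ico (0 : ℝ) 1) :
    (-1) ^ (m + 1) * logPolylogSum m (((p : ℤ) + 3) :: ones k) t +
      (-1) ^ (p + k + 1) * logPolylogSum k (((p : ℤ) + 3) :: ones m) t =
    (-1) ^ m * logPow (m + 1) t * altPolylog (((p : ℤ) + 3) :: ones k) t +
      (-1) ^ (p + k) * logPow (k + 1) t * altPolylog (((p : ℤ) + 3) :: ones m) t +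
      polylogConvolution m k p t := by
  have hp : (0 : ℤ) < p + 3 := by omega
  refine eq_of_hasDerivAt_eq
    (f := fun x => (-1) ^ (m + 1) * logPolylogSum m (((p : ℤ) + 3) :: ones k) x +
      (-1) ^ (p + k + 1) * logPolylogSum k (((p : ℤ) + 3) :: ones m) x)
    (g := fun x => (-1) ^ m * logPow (m + 1) x * altPolylog (((p : ℤ) + 3) :: ones k) x +
      (-1) ^ (p + k) * logPow (k + 1) x * altPolylog (((p : ℤ) + 3) :: ones m) x +
      polylogConvolution m k p x)
    (d := fun x => (-1) ^ (m + 1) *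
        (-(logPow m x * altPolylog (((p : ℤ) + 3) :: ones k) x / (1 + x))) +
      (-1) ^ (p + k + 1) *
        (-(logPow k x * altPolylog (((p : ℤ) + 3) :: ones m) x / (1 + x)))) ?_ ?_ ?_ ?_ ?_ ht
  · have hz : polylogConvolution m k p 0 = 0 := Finset.sum_eq_zero fun i _ => by
      rw [altPolylog_cons_zero (by omega), mul_zero, zero_mul]
    simp only [logPolylogSum_zero, logPow_succ_zero, hz, mul_zero, zero_mul, add_zero]
  · exact ((hasDerivAt_logPolylogSum m (cons_ones_pos hp k) (by simp)).continuousAt.const_mul _).add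
      ((hasDerivAt_logPolylogSum k (cons_ones_pos hp m) (by simp)).continuousAt.const_mul _)
  · refine ((((continuousAt_logPow _ (by norm_num)).const_mul _).mul
      (continuousAt_altPolylog_zero (cons_ones_pos hp k))).add
      (((continuousAt_logPow _ (by norm_num)).const_mul _).mul
      (continuousAt_altPolylog_zero (cons_ones_pos hp m)))).add ?_
    refine tendsto_finsetSum _ fun i hi => ?_
    have := Finset.mem_range.1 hi
    exact ((continuousAt_altPolylog_zero (cons_ones_pos (by omega) m)).const_mul _).mul
      (continuousAt_altPolylog_zero (cons_ones_pos (by omega) k))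
  · intro x hx
    have hx1 : |x| < 1 := by rw [abs_of_pos hx.1]; exact hx.2
    exact ((hasDerivAt_logPolylogSum m (cons_ones_pos hp k) hx1).const_mul _).add
      ((hasDerivAt_logPolylogSum k (cons_ones_pos hp m) hx1).const_mul _)
  · intro x hx
    have hx1 : |x| < 1 := by rw [abs_of_pos hx.1]; exact hx.2
    have hx2 : 1 + x ≠ 0 := by linarith [hx.1]
    have h1 := hasDerivAt_altPolylog_succ (s := (p : ℤ) + 2) (by omega) (ones_pos k) hx1 hx.1.ne'
    have h2 := hasDerivAt_altPolylog_succ (s := (p : ℤ) + 2) (by omega) (ones_pos m) hx1 hx.1.ne'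
    rw [show (p : ℤ) + 2 + 1 = p + 3 by ring] at h1 h2
    refine (((((hasDerivAt_logPow_succ m hx2).const_mul _).mul h1).add
      (((hasDerivAt_logPow_succ k hx2).const_mul _).mul h2)).add
      (hasDerivAt_polylogConvolution m k p hx)).congr_deriv ?_
    -- The `1 / t` terms from the convolution now cancel those from differentiating the
    -- polylogarithms of index `p + 3`.
    rw [altPolylog_ones (m + 1) ⟨hx.1.le, hx.2⟩, altPolylog_ones (k + 1) ⟨hx.1.le, hx.2⟩]
    ring

/-! ### Passage to the limit `t → 1⁻`. -/

/-- Abel's theorem for multiple polylogarithms. -/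
theorem tendsto_altPolylog_nhdsLT_one {s : ℤ} (hs : 0 < s) {l : List ℤ} {a : ℝ}
    (h : Tendsto (multipleHarmonicNumber (-s :: l)) atTop (𝓝 a)) :
    Tendsto (altPolylog (s :: l)) (𝓝[<] 1) (𝓝 a) := by
  refine Real.tendsto_tsum_powerSeries_nhdsWithin_lt ((tendsto_add_atTop_iff_nat 1).1 ?_)
  exact h.congr (multipleHarmonicNumber_neg_cons hs l)

theorem tendsto_multipleZeta_neg {s : ℤ} (hs : 2 ≤ s) {l : List ℤ} (hl : ∀ x ∈ l, 0 < x) :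
    Tendsto (multipleHarmonicNumber (-s :: l)) atTop (𝓝 (multipleZeta (-s :: l))) :=
  tendsto_nhds_limUnder (exists_tendsto_multipleHarmonicNumber_neg hs hl)

theorem tendsto_multipleZeta_neg_one (a : ℕ) {s : ℤ} (hs : 0 < s) {l : List ℤ}
    (hl : ∀ x ∈ l, 0 < x) :
    Tendsto (multipleHarmonicNumber (-1 :: (ones a ++ s :: l))) atTop
      (𝓝 (multipleZeta (-1 :: (ones a ++ s :: l)))) := by
  have hsl : ∀ x ∈ s :: l, 0 < x := by
    simp only [List.mem_cons, forall_eq_or_imp]; exact ⟨hs, hl⟩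
  refine tendsto_nhds_limUnder ?_
  cases a with
  | zero => exact exists_tendsto_multipleHarmonicNumber_neg_one hs hl
  | succ a =>
    exact exists_tendsto_multipleHarmonicNumber_neg_one one_pos (ones_append_pos hsl a)

theorem tendsto_logPow (i : ℕ) :
    Tendsto (logPow i) (𝓝[<] 1) (𝓝 (Real.log 2 ^ i / (i.factorial : ℝ))) := by
  have h : Tendsto (logPow i) (𝓝[<] 1) (𝓝 (logPow i 1)) :=
    (continuousAt_logPow i (by norm_num)).continuousWithinAt
  rwa [logPow, show (1 : ℝ) + 1 = 2 by norm_num] at h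

theorem tendsto_logPolylogSum (m : ℕ) {s : ℤ} (hs : 0 < s) {l : List ℤ} (hl : ∀ x ∈ l, 0 < x) :
    Tendsto (logPolylogSum m (s :: l)) (𝓝[<] 1)
      (𝓝 (∑ i ∈ Finset.range (m + 1), Real.log 2 ^ i / (i.factorial : ℝ) *
        multipleZeta (-1 :: (ones (m - i) ++ s :: l)))) :=
  tendsto_finsetSum _ fun i _ => (tendsto_logPow i).mul
    (tendsto_altPolylog_nhdsLT_one one_pos (tendsto_multipleZeta_neg_one (m - i) hs hl))

theorem theorem4p1 (m k p : ℕ) :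
    -- all the series that occur converge
    (∀ a b : ℕ, Tendsto (multipleHarmonicNumber (-1 :: (ones a ++ ((p : ℤ) + 3) :: ones b)))
      atTop (𝓝 (multipleZeta (-1 :: (ones a ++ ((p : ℤ) + 3) :: ones b))))) ∧
    (∀ q b : ℕ, Tendsto (multipleHarmonicNumber (-((q : ℤ) + 2) :: ones b))
      atTop (𝓝 (multipleZeta (-((q : ℤ) + 2) :: ones b)))) ∧
    -- the identity
    (-1 : ℝ) ^ (m + 1) * ∑ i ∈ Finset.range (m + 1),
        Real.log 2 ^ i / (i.factorial : ℝ) *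
          multipleZeta (-1 :: (ones (m - i) ++ ((p : ℤ) + 3) :: ones k)) +
      (-1 : ℝ) ^ (p + k + 1) * ∑ i ∈ Finset.range (k + 1),
        Real.log 2 ^ i / (i.factorial : ℝ) *
          multipleZeta (-1 :: (ones (k - i) ++ ((p : ℤ) + 3) :: ones m)) =
    (-1 : ℝ) ^ m / ((m + 1).factorial : ℝ) * Real.log 2 ^ (m + 1) *
        multipleZeta (-((p : ℤ) + 3) :: ones k) +
      (-1 : ℝ) ^ (p + k) / ((k + 1).factorial : ℝ) * Real.log 2 ^ (k + 1) *
        multipleZeta (-((p : ℤ) + 3) :: ones m) +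
      ∑ i ∈ Finset.range (p + 1), (-1 : ℝ) ^ i *
        multipleZeta (-((i : ℤ) + 2) :: ones m) *
        multipleZeta (-((p : ℤ) + 2 - (i : ℤ)) :: ones k) := by
  refine ⟨fun a b => tendsto_multipleZeta_neg_one a (by omega) (ones_pos b),
    fun q b => tendsto_multipleZeta_neg (by omega) (ones_pos b), ?_⟩
  have hz : ∀ {s : ℤ} (_ : 2 ≤ s) (b : ℕ), Tendsto (altPolylog (s :: ones b)) (𝓝[<] 1)
      (𝓝 (multipleZeta (-s :: ones b))) := fun hs b =>
    tendsto_altPolylog_nhdsLT_one (by omega) (tendsto_multipleZeta_neg hs (ones_pos b))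
  have hl := ((tendsto_logPolylogSum m (s := (p : ℤ) + 3) (by omega)
    (ones_pos k)).const_mul ((-1 : ℝ) ^ (m + 1))).add
    ((tendsto_logPolylogSum k (s := (p : ℤ) + 3) (by omega)
    (ones_pos m)).const_mul ((-1 : ℝ) ^ (p + k + 1)))
  have hc : Tendsto (polylogConvolution m k p) (𝓝[<] 1)
      (𝓝 (∑ i ∈ Finset.range (p + 1), (-1 : ℝ) ^ i *
        multipleZeta (-((i : ℤ) + 2) :: ones m) *
        multipleZeta (-((p : ℤ) + 2 - (i : ℤ)) :: ones k))) := by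
    refine tendsto_finsetSum _ fun i hi => ?_
    -- `i ≤ p` keeps `p + 2 - i` at least `2`, in the convergent range.
    have := Finset.mem_range.1 hi
    exact ((hz (by omega) m).const_mul _).mul (hz (by omega) k)
  have hr := ((((tendsto_logPow (m + 1)).const_mul ((-1 : ℝ) ^ m)).mul
    (hz (s := (p : ℤ) + 3) (by omega) k)).add
    (((tendsto_logPow (k + 1)).const_mul ((-1 : ℝ) ^ (p + k))).mul
    (hz (s := (p : ℤ) + 3) (by omega) m))).add hc
  have hev : ∀ᶠ t : ℝ in 𝓝[<] 1, t ∈ Set.Ico (0 : ℝ) 1 :=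
    Ico_mem_nhdsLT one_pos
  have key := tendsto_nhds_unique_of_eventuallyEq hl hr
    (hev.mono fun t ht => logPolylogSum_identity m k p ht)
  rw [key]
  ring
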